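/- Let $q$ be a prime power and let $n\ge 1$, $k\ge 0$ be integers with $n\le q+1$ and $2k\le n$, and suppose that $n-2k\geq 2$, or $n=2k$, or $n=2k+1\le q$ (that is, only the case $n=q+1=2k+1$ is left out). Then there exists a $q$-ary $[[n,n-2k,k+1]]$ quantum MDS code. Here a $q$-ary $[[n,\kappa,d]]$ quantum code is a subspace $Q$ of $(\mathbb C^q)^{\otimes n}$ of dimension $q^{\kappa}$ that detects $d-1$ errors and corrects $\lfloor (d-1)/2\rfloor$ errors. An error on at most $t$ coordinates is any linear operator on $(\mathbb C^q)^{\otimes n}$ that acts as the identity on all tensor factors outside some set of at most $t$ coordinates. $Q$ detects $t$ errors if for each error $E$ on at most $t$ coordinates there is a scalar $c_E$ with $\langle\varphi, E\psi\rangle=c_E\langle\varphi,\psi\rangle$ for all $\varphi,\psi\in Q$. $Q$ corrects $t$ errors if there are operators $R_1,\dots,R_r$ with $\sum_j R_j^{\dagger}R_j=I$ such that for each error $E$ on at most $t$ coordinates and each $j$ there is a scalar $c_{E,j}$ with $R_jE\psi=c_{E,j}\psi$ for all $\psi\in Q$. If $\dim Q=1$, one requires moreover, as usual, that $\langle\varphi,E\psi\rangle=q^{-n}\operatorname{tr}(E)\langle\varphi,\psi\rangle$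 for all $\varphi,\psi\in Q$ and all errors $E$ on at most $d-1$ coordinates. The code is a quantum MDS code if it attains the quantum Singleton bound $n\ge \kappa+2d-2$, that is, $n=\kappa+2d-2$. -/

import Mathlib

namespace QuantumCode

/-- The state space `(ℂ^q)^{⊗ n} = ℂ^(q^n)` of `n` qudits, with `q = |A|`: the Hilbert space with
orthonormal basis `|x⟩`, `x ∈ A^n`. -/
abbrev StateSpace (A : Type*) (n : ℕ) : Type _ := EuclideanSpace ℂ (Fin n → A)

/-- Linear operators on the state space, as matrices in the basis `|x⟩`, `x ∈ A^n`. -/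
abbrev Op (A : Type*) (n : ℕ) : Type _ := Matrix (Fin n → A) (Fin n → A) ℂ

/-- `E` acts only on the coordinates in `S`: it is the tensor product of an operator `M` on the
qudits in `S` with the identity on the other qudits. -/
def ActsOn {A : Type*} {n : ℕ} (S : Finset (Fin n)) (E : Op A n) : Prop :=
  ∃ M : Matrix (S → A) (S → A) ℂ,
    (∀ x y : Fin n → A, (∀ i, i ∉ S → x i = y i) →
      E x y = M (fun i => x i) (fun i => y i)) ∧
    (∀ x y : Fin n → A, (∃ i, i ∉ S ∧ x i ≠ y i) → E x y = 0)

/-- `E` is an error affecting at most `t` of the `n` qudits. -/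
def IsError {A : Type*} {n : ℕ} (t : ℕ) (E : Op A n) : Prop :=
  ∃ S : Finset (Fin n), S.card ≤ t ∧ ActsOn S E

/-- The vector `E ψ`. -/
noncomputable def act {A : Type*} [Fintype A] [DecidableEq A] {n : ℕ}
    (E : Op A n) (ψ : StateSpace A n) : StateSpace A n :=
  Matrix.toEuclideanLin E ψ

/-- `Q` detects `t` errors: for every error `E` on at most `t` qudits there is a scalar `c`
with `P E P = c P`, where `P` is the orthogonal projection onto `Q`. -/
def Detects {A : Type*} [Fintype A] [DecidableEq A] {n : ℕ}
    (Q : Submodule ℂ (StateSpace A n)) (t : ℕ) : Prop :=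
  ∀ E : Op A n, IsError t E →
    ∃ c : ℂ, ∀ φ ∈ Q, ∀ ψ ∈ Q, inner ℂ φ (act E ψ) = c * inner ℂ φ ψ

/-- `Q` corrects `t` errors: there is one recovery operation (a quantum channel with Kraus
operators `R j`) that restores every state of `Q`, up to scalars that do not depend on the state,
after an arbitrary error on at most `t` qudits. -/
def Corrects {A : Type*} [Fintype A] [DecidableEq A] {n : ℕ}
    (Q : Submodule ℂ (StateSpace A n)) (t : ℕ) : Prop :=
  ∃ (r : ℕ) (R : Fin r → Op A n),
    ∑ j, (R j).conjTranspose * R j = 1 ∧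
    ∀ E : Op A n, IsError t E →
      ∀ j, ∃ c : ℂ, ∀ ψ ∈ Q, act (R j) (act E ψ) = c • ψ

/-- `Q` is pure to order `t`: in the condition for detecting errors on at most `t` qudits the
scalar is the normalized trace; equivalently, traceless such errors map `Q` into its orthogonal
complement. -/
def IsPure {A : Type*} [Fintype A] [DecidableEq A] {n : ℕ}
    (Q : Submodule ℂ (StateSpace A n)) (t : ℕ) : Prop :=
  ∀ E : Op A n, IsError t E → ∀ φ ∈ Q, ∀ ψ ∈ Q,
    inner ℂ φ (act E ψ) = (E.trace / (Fintype.card A : ℂ) ^ n) * inner ℂ φ ψ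

/-- `Q` is a `q`-ary `[[n, k, d]]` quantum code, `q = |A|`: a subspace of dimension `q ^ k` that
detects `d - 1` errors and corrects `⌊(d - 1) / 2⌋` errors. For one-dimensional codes, where
detection is an empty condition, the usual convention is in force: such a code has distance `d`
only if it is pure to order `d - 1`. -/
structure IsCode {A : Type*} [Fintype A] [DecidableEq A] {n : ℕ}
    (Q : Submodule ℂ (StateSpace A n)) (k d : ℕ) : Prop where
  one_le_dist : 1 ≤ d
  finrank_eq : Module.finrank ℂ Q = Fintype.card A ^ k
  detects : Detects Q (d - 1)
  corrects : Corrects Q ((d - 1) / 2)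
  pure_of_finrank_eq_one : Module.finrank ℂ Q = 1 → IsPure Q (d - 1)

/-- `Q` is a `q`-ary `[[n, k, d]]` quantum MDS code: an `[[n, k, d]]` code attaining the quantum
Singleton bound `n ≥ k + 2 d - 2`. -/
def IsMDS {A : Type*} [Fintype A] [DecidableEq A] {n : ℕ}
    (Q : Submodule ℂ (StateSpace A n)) (k d : ℕ) : Prop :=
  IsCode Q k d ∧ n + 2 = k + 2 * d

end QuantumCode

namespace QuantumCode

open scoped Matrix

/-! The code is of CSS type, built from two nested MDS codes. Fix `n` points of the projective line
over `F` and a monic `h` of degree `n - 2k` that vanishes at none of them. Let `C` be the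
evaluations of polynomials of degree `< n - k`, and `D ≤ C` those of the multiples `h * g` with `deg
g < k`. Nonzero words of `C` have weight `> k`, and `D` takes arbitrary values on any `k`
coordinates (`exists_nested_mds`). The vectors supported on `C` and invariant under `D` form a space
of dimension `q ^ (n - 2k)`, and these two properties make it pure to order `k`
(`isLocallyPure_cssCode`). Purity gives detection at once, and correction through the Knill-Laflamme
conditions (`IsLocallyPure.corrects`). If `n - 2k ≠ 1`, some `h` has no root in `F`, so all `q + 1`
points are available; if `n - 2k = 1`, the root of `h` costs one point. -/

/-- A translation-invariant form of `ActsOn`: `E` preserves the coordinates outside `S`, and its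
entries do not depend on them. -/
structure IsLocal {A : Type*} [AddGroup A] {n : ℕ} (S : Finset (Fin n)) (E : Op A n) : Prop where
  eq_zero : ∀ x y : Fin n → A, (∃ i, i ∉ S ∧ x i ≠ y i) → E x y = 0
  add_right : ∀ w : Fin n → A, (∀ i ∈ S, w i = 0) → ∀ x y, E (x + w) (y + w) = E x y

/-! ### Calculus of local operators -/

section Local

variable {A : Type*} [AddGroup A] {n : ℕ} {S T : Finset (Fin n)} {E G : Op A n}

theorem ActsOn.isLocal (h : ActsOn S E) : IsLocal S E := by
  obtain ⟨M, h1, h2⟩ := h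
  refine ⟨h2, fun w hw x y => ?_⟩
  by_cases hxy : ∃ i, i ∉ S ∧ x i ≠ y i
  · rw [h2 x y hxy]
    obtain ⟨i, hi, hne⟩ := hxy
    exact h2 _ _ ⟨i, hi, by simpa using hne⟩
  · push Not at hxy
    rw [h1 x y hxy, h1 _ _ fun i hi => by simp [hxy i hi]]
    congr 1 <;> funext i <;> simp [hw i i.2]

theorem IsLocal.mono (h : IsLocal S E) (hST : S ⊆ T) : IsLocal T E :=
  ⟨fun x y ⟨i, hi, hne⟩ => h.eq_zero x y ⟨i, fun h' => hi (hST h'), hne⟩,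
    fun w hw => h.add_right w fun i hi => hw i (hST hi)⟩

theorem IsLocal.conjTranspose (h : IsLocal S E) : IsLocal S Eᴴ := by
  refine ⟨fun x y ⟨i, hi, hne⟩ => ?_, fun w hw x y => ?_⟩
  · rw [Matrix.conjTranspose_apply, h.eq_zero y x ⟨i, hi, hne.symm⟩, star_zero]
  · simp only [Matrix.conjTranspose_apply, h.add_right w hw]

theorem IsLocal.mul [Fintype A] (hE : IsLocal S E) (hG : IsLocal S G) :
    IsLocal S (E * G) := by
  refine ⟨fun x y ⟨i, hi, hne⟩ => ?_, fun w hw x y => ?_⟩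
  · rw [Matrix.mul_apply]
    refine Finset.sum_eq_zero fun z _ => ?_
    by_cases hz : x i = z i
    · rw [hG.eq_zero z y ⟨i, hi, hz ▸ hne⟩, mul_zero]
    · rw [hE.eq_zero x z ⟨i, hi, hz⟩, zero_mul]
  · rw [Matrix.mul_apply, Matrix.mul_apply]
    exact (Fintype.sum_equiv (Equiv.addRight w) _ _ fun z => by
      simp only [Equiv.coe_addRight, hE.add_right w hw, hG.add_right w hw]).symm

end Local

/-! ### Projections and recovery operations -/

section Act

variable {A : Type*} [Fintype A] [DecidableEq A] {n : ℕ}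

theorem act_act (E G : Op A n) (ψ : StateSpace A n) : act E (act G ψ) = act (E * G) ψ := by
  ext x
  simp [act, Matrix.toLpLin_apply, Matrix.mulVec_mulVec]

theorem inner_act (E : Op A n) (φ ψ : StateSpace A n) :
    inner ℂ φ (act E ψ) = ∑ x, ∑ y, star (φ x) * E x y * ψ y := by
  simp only [act, PiLp.inner_apply, Matrix.toLpLin_apply, Matrix.mulVec, dotProduct,
    RCLike.inner_apply, Finset.sum_mul]
  refine Finset.sum_congr rfl fun x _ => Finset.sum_congr rfl fun y _ => ?_
  simp only [starRingEnd_apply]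
  ring

theorem inner_act_conjTranspose (E : Op A n) (φ ψ : StateSpace A n) :
    inner ℂ φ (act Eᴴ ψ) = inner ℂ (act E φ) ψ := by
  simp only [act]
  rw [Matrix.toEuclideanLin_conjTranspose_eq_adjoint, LinearMap.adjoint_inner_right]

theorem act_injective : Function.Injective (act (A := A) (n := n)) := fun _ _ h =>
  Matrix.toEuclideanLin.injective (LinearMap.ext fun ψ => congrFun h ψ)

/-- The matrix of the orthogonal projection onto `Q`. -/
noncomputable def projMatrix (Q : Submodule ℂ (StateSpace A n)) : Op A n :=
  (Matrix.toEuclideanCLM (n := Fin n → A) (𝕜 := ℂ)).symm Q.starProjection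

theorem act_projMatrix (Q : Submodule ℂ (StateSpace A n)) (ψ : StateSpace A n) :
    act (projMatrix Q) ψ = Q.starProjection ψ := by
  have := Matrix.coe_toEuclideanCLM_eq_toEuclideanLin (𝕜 := ℂ) (projMatrix Q)
  rw [act, ← this]
  simp [projMatrix]

theorem projMatrix_mul_self (Q : Submodule ℂ (StateSpace A n)) :
    projMatrix Q * projMatrix Q = projMatrix Q := by
  rw [projMatrix, ← map_mul, Q.isIdempotentElem_starProjection]

theorem conjTranspose_projMatrix (Q : Submodule ℂ (StateSpace A n)) :
    (projMatrix Q)ᴴ = projMatrix Q := by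
  refine act_injective (funext fun ψ => ext_inner_left ℂ fun φ => ?_)
  rw [inner_act_conjTranspose, act_projMatrix, act_projMatrix,
    Q.inner_starProjection_left_eq_right]

/-- If every error of a set is a combination of operators `B j` which are orthonormal on `Q` in the
sense of Knill and Laflamme, then one recovery operation corrects all of them. -/
theorem exists_recovery (Q : Submodule ℂ (StateSpace A n)) {m : ℕ} (B : Fin m → Op A n)
    (hB : ∀ i j, projMatrix Q * ((B i)ᴴ * B j) * projMatrix Q
      = (if i = j then (1 : ℂ) else 0) • projMatrix Q) :
    ∃ (r : ℕ) (R : Fin r → Op A n), ∑ j, (R j)ᴴ * R j = 1 ∧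
      ∀ E ∈ Submodule.span ℂ (Set.range B), ∀ j, ∃ c : ℂ, ∀ ψ ∈ Q,
        act (R j) (act E ψ) = c • ψ := by
  set P := projMatrix Q with hP
  have hPP : P * P = P := projMatrix_mul_self Q
  have hPs : Pᴴ = P := conjTranspose_projMatrix Q
  -- `T` projects onto the sum of the mutually orthogonal spaces `B j Q`.
  set T : Op A n := ∑ j, B j * P * (B j)ᴴ with hT
  have hTB : ∀ i, T * (B i * P) = B i * P := by
    intro i
    rw [hT, Finset.sum_mul, Finset.sum_eq_single i]
    · have := hB i i
      rw [if_pos rfl, one_smul] at this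
      calc B i * P * (B i)ᴴ * (B i * P) = B i * (P * ((B i)ᴴ * B i) * P) := by
            simp only [mul_assoc]
        _ = _ := by rw [this]
    · intro j _ hj
      have := hB j i
      rw [if_neg hj, zero_smul] at this
      calc B j * P * (B j)ᴴ * (B i * P) = B j * (P * ((B j)ᴴ * B i) * P) := by
            simp only [mul_assoc]
        _ = _ := by rw [this, mul_zero]
    · simp
  have hTs : Tᴴ = T := by
    simp only [hT, Matrix.conjTranspose_sum, Matrix.conjTranspose_mul,
      Matrix.conjTranspose_conjTranspose, hPs, mul_assoc]
  have hTT : T * T = T := by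
    conv_lhs => rhs; rw [hT]
    rw [Finset.mul_sum, hT]
    exact Finset.sum_congr rfl fun j _ => by rw [← mul_assoc, ← hT, hTB]
  -- `P * (B j)ᴴ` carries `B j Q` back to `Q`; `1 - T` completes the channel and kills every `B j
  -- Q`.
  refine ⟨m + 1, Fin.cons (1 - T) fun j => P * (B j)ᴴ, ?_, ?_⟩
  · rw [Fin.sum_univ_succ]
    simp only [Fin.cons_zero, Fin.cons_succ, Matrix.conjTranspose_sub, Matrix.conjTranspose_one,
      hTs, Matrix.conjTranspose_mul, Matrix.conjTranspose_conjTranspose, hPs]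
    have h1 : (1 - T) * (1 - T) = 1 - T := by
      rw [mul_sub, sub_mul, sub_mul, hTT]; simp
    have h2 : ∑ j, B j * P * (P * (B j)ᴴ) = T := by
      rw [hT]
      exact Finset.sum_congr rfl fun j _ => by rw [← mul_assoc, mul_assoc (B j), hPP]
    rw [h1, h2, sub_add_cancel]
  · intro E hE j
    suffices h : ∃ c : ℂ, (Fin.cons (1 - T) (fun j => P * (B j)ᴴ) : Fin (m + 1) → Op A n) j
        * E * P = c • P by
      obtain ⟨c, hc⟩ := h
      refine ⟨c, fun ψ hψ => ?_⟩
      have hψ' : act P ψ = ψ := by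
        rw [hP, act_projMatrix, Submodule.starProjection_eq_self_iff.2 hψ]
      conv_lhs => rw [← hψ']
      rw [act_act, act_act, hc]
      conv_rhs => rw [← hψ']
      simp [act]
    induction hE using Submodule.span_induction with
    | mem E h =>
      obtain ⟨i, rfl⟩ := h
      refine Fin.cases ⟨0, ?_⟩ (fun j => ⟨if j = i then 1 else 0, ?_⟩) j
      · rw [Fin.cons_zero, mul_assoc, sub_mul, one_mul, hTB, sub_self, zero_smul]
      · rw [Fin.cons_succ, ← hB, mul_assoc P]
    | zero => exact ⟨0, by simp⟩
    | add x y _ _ hx hy =>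
      obtain ⟨c, hc⟩ := hx
      obtain ⟨d, hd⟩ := hy
      exact ⟨c + d, by rw [mul_add, add_mul, hc, hd, add_smul]⟩
    | smul a x _ hx =>
      obtain ⟨c, hc⟩ := hx
      exact ⟨a * c, by rw [Matrix.mul_smul, Matrix.smul_mul, hc, smul_smul]⟩

/-- A finite-dimensional space of matrices has a basis which is orthonormal for the trace form. -/
theorem exists_trace_orthonormal_span {ι : Type*} [Fintype ι] (V : Submodule ℂ (Matrix ι ι ℂ)) :
    ∃ (m : ℕ) (B : Fin m → Matrix ι ι ℂ), Submodule.span ℂ (Set.range B) = V ∧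
      ∀ i j, ((B i)ᴴ * B j).trace = if i = j then 1 else 0 := by
  let e : EuclideanSpace ℂ (ι × ι) ≃ₗ[ℂ] Matrix ι ι ℂ :=
    (WithLp.linearEquiv 2 ℂ (ι × ι → ℂ)).trans (LinearEquiv.curry ℂ ℂ ι ι)
  have he : ∀ a b, ((e a)ᴴ * e b).trace = inner ℂ a b := by
    intro a b
    simp only [Matrix.trace, Matrix.diag, Matrix.mul_apply, PiLp.inner_apply,
      Fintype.sum_prod_type_right, RCLike.inner_apply, Matrix.conjTranspose_apply]
    refine Finset.sum_congr rfl fun x _ => Finset.sum_congr rfl fun y _ => ?_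
    exact mul_comm _ _
  let W : Submodule ℂ (EuclideanSpace ℂ (ι × ι)) := V.comap e.toLinearMap
  let b := stdOrthonormalBasis ℂ W
  refine ⟨_, fun i => e (b i), ?_, fun i j => ?_⟩
  · have h1 : Submodule.span ℂ (Set.range fun i => (b i : EuclideanSpace ℂ (ι × ι))) = W := by
      have := b.toBasis.span_eq
      have h2 := congrArg (Submodule.map W.subtype) this
      rw [Submodule.map_span, ← Set.range_comp, Submodule.map_top, Submodule.range_subtype] at h2
      simpa [Function.comp_def] using h2
    have h3 := congrArg (Submodule.map e.toLinearMap) h1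
    rw [Submodule.map_span, ← Set.range_comp] at h3
    rw [show V = W.map e.toLinearMap from
      (Submodule.map_comap_eq_of_surjective e.surjective V).symm, ← h3]
    rfl
  · rw [he, ← Submodule.coe_inner, b.inner_eq_ite]

end Act

/-! ### Purity implies detection and correction -/

section Pure

variable {A : Type*} [AddGroup A] [Fintype A] [DecidableEq A] {n : ℕ}
  {Q : Submodule ℂ (StateSpace A n)}

/-- Purity for the translation-invariant form of locality. -/
def IsLocallyPure (Q : Submodule ℂ (StateSpace A n)) (k : ℕ) : Prop :=
  ∀ (S : Finset (Fin n)) (E : Op A n), S.card ≤ k → IsLocal S E → ∀ φ ∈ Q, ∀ ψ ∈ Q,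
    inner ℂ φ (act E ψ) = (E.trace / (Fintype.card A : ℂ) ^ n) * inner ℂ φ ψ

theorem IsLocallyPure.isPure {k : ℕ} (h : IsLocallyPure Q k) : IsPure Q k :=
  fun E ⟨S, hS, hE⟩ => h S E hS hE.isLocal

omit [AddGroup A] in
theorem IsPure.detects {k : ℕ} (h : IsPure Q k) : Detects Q k :=
  fun E hE => ⟨_, h E hE⟩

theorem IsLocallyPure.projMatrix_mul {k : ℕ} (h : IsLocallyPure Q k) {S : Finset (Fin n)}
    {E : Op A n} (hS : S.card ≤ k) (hE : IsLocal S E) :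
    projMatrix Q * E * projMatrix Q
      = (E.trace / (Fintype.card A : ℂ) ^ n) • projMatrix Q := by
  apply act_injective
  funext ψ
  refine ext_inner_left ℂ fun φ => ?_
  have h1 : act ((E.trace / (Fintype.card A : ℂ) ^ n) • projMatrix Q) ψ
      = (E.trace / (Fintype.card A : ℂ) ^ n) • act (projMatrix Q) ψ := by simp [act]
  rw [h1, ← act_act, ← act_act, inner_smul_right]
  have h2 : ∀ χ, inner ℂ φ (act (projMatrix Q) χ) = inner ℂ (act (projMatrix Q) φ) χ := by
    intro χ
    rw [← inner_act_conjTranspose, conjTranspose_projMatrix]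
  rw [h2]
  have hm : ∀ χ, act (projMatrix Q) χ ∈ Q := fun χ => by
    rw [act_projMatrix]; exact Q.starProjection_apply_mem χ
  rw [h S E hS hE _ (hm _) _ (hm _), ← h2, act_act, projMatrix_mul_self]

/-- For two errors on at most `t` coordinates, `Eᴴ * G` lives on at most `2t ≤ k` coordinates.
Purity thus turns the Knill-Laflamme form on the span of the errors into the normalized trace form,
which an orthonormal basis diagonalizes. -/
theorem IsLocallyPure.corrects {k t : ℕ} (h : IsLocallyPure Q k) (ht : 2 * t ≤ k) :
    Corrects Q t := by
  set V : Submodule ℂ (Op A n) := Submodule.span ℂ {E | IsError t E} with hV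
  obtain ⟨m, B, hspan, hB⟩ := exists_trace_orthonormal_span V
  have hN : (0 : ℝ) < (Fintype.card A : ℝ) ^ n := by
    have : 0 < Fintype.card A := Fintype.card_pos_iff.2 ⟨0⟩
    positivity
  have hkey : ∀ E ∈ V, ∀ G ∈ V, projMatrix Q * (Eᴴ * G) * projMatrix Q
      = ((Eᴴ * G).trace / (Fintype.card A : ℂ) ^ n) • projMatrix Q := by
    intro E hE G hG
    induction hE, hG using Submodule.span_induction₂ with
    | mem_mem E G hE hG =>
      obtain ⟨S, hS, hE⟩ := hE
      obtain ⟨T, hT, hG⟩ := hG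
      refine h.projMatrix_mul (S := S ∪ T) ((Finset.card_union_le S T).trans (by omega)) ?_
      exact (hE.isLocal.mono Finset.subset_union_left).conjTranspose.mul
        (hG.isLocal.mono Finset.subset_union_right)
    | zero_left => simp
    | zero_right => simp
    | add_left x y z _ _ _ hx hy =>
      simp only [Matrix.conjTranspose_add, add_mul, mul_add, Matrix.trace_add, add_div, add_smul,
        hx, hy]
    | add_right x y z _ _ _ hx hy =>
      simp only [add_mul, mul_add, Matrix.trace_add, add_div, add_smul, hx, hy]
    | smul_left a x y _ _ hx =>
      simp only [Matrix.conjTranspose_smul, Matrix.smul_mul, Matrix.mul_smul, Matrix.trace_smul,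
        hx, smul_smul, smul_eq_mul, mul_div_assoc]
    | smul_right a x y _ _ hx =>
      simp only [Matrix.smul_mul, Matrix.mul_smul, Matrix.trace_smul,
        hx, smul_smul, smul_eq_mul, mul_div_assoc]
  -- Rescaling the basis by `s = q ^ (n / 2)` cancels the normalization of the trace.
  set s : ℂ := ((Real.sqrt ((Fintype.card A : ℝ) ^ n) : ℝ) : ℂ) with hs
  have hss : star s * s = (Fintype.card A : ℂ) ^ n := by
    rw [hs, Complex.star_def, Complex.conj_ofReal, ← Complex.ofReal_mul,
      Real.mul_self_sqrt hN.le]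
    push_cast
    rfl
  have hNC : (Fintype.card A : ℂ) ^ n ≠ 0 := by exact_mod_cast hN.ne'
  have hs0 : s ≠ 0 := fun h0 => hNC (by rw [← hss, h0, mul_zero])
  have hBV : ∀ i, B i ∈ V := fun i => hspan ▸ Submodule.subset_span ⟨i, rfl⟩
  obtain ⟨r, R, hR, hrec⟩ := exists_recovery Q (fun i => s • B i) fun i j => by
    rw [hkey _ (V.smul_mem s (hBV i)) _ (V.smul_mem s (hBV j)), Matrix.conjTranspose_smul,
      Matrix.smul_mul, Matrix.mul_smul, smul_smul, hss, Matrix.trace_smul, hB, smul_eq_mul,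
      mul_div_cancel_left₀ _ hNC]
  refine ⟨r, R, hR, fun E hE => hrec E ?_⟩
  have h1 : V ≤ Submodule.span ℂ (Set.range fun i => s • B i) := by
    rw [← hspan, Submodule.span_le]
    rintro _ ⟨i, rfl⟩
    have : B i = s⁻¹ • s • B i := by rw [smul_smul, inv_mul_cancel₀ hs0, one_smul]
    rw [this]
    exact Submodule.smul_mem _ _ (Submodule.subset_span ⟨i, rfl⟩)
  exact h1 (Submodule.subset_span hE)

end Pure

end QuantumCode
namespace QuantumCode

/-! ### CSS codes -/

section CSS

variable {F : Type*} [Field F] {n : ℕ}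

/-- The vectors supported on the code `C` and invariant under translation by the code `D`. -/
def cssCode (C D : Submodule F (Fin n → F)) : Submodule ℂ (StateSpace F n) where
  carrier := {ψ | (∀ x, x ∉ C → ψ x = 0) ∧ ∀ x, ∀ d ∈ D, ψ (x + d) = ψ x}
  zero_mem' := ⟨fun _ _ => rfl, fun _ _ _ => rfl⟩
  add_mem' := fun {a b} ha hb => ⟨fun x hx => by simp [ha.1 x hx, hb.1 x hx],
    fun x d hd => by simp [ha.2 x d hd, hb.2 x d hd]⟩
  smul_mem' := fun c a ha => ⟨fun x hx => by simp [ha.1 x hx],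
    fun x d hd => by simp [ha.2 x d hd]⟩

variable {C D : Submodule F (Fin n → F)}

theorem mem_cssCode {ψ : StateSpace F n} : ψ ∈ cssCode C D ↔
    (∀ x, x ∉ C → ψ x = 0) ∧ ∀ x, ∀ d ∈ D, ψ (x + d) = ψ x := Iff.rfl

open Classical in
/-- A function on the quotient `C / D`, as a vector of the code. -/
noncomputable def cssEncode (C D : Submodule F (Fin n → F)) :
    ((C ⧸ D.comap C.subtype) → ℂ) →ₗ[ℂ] StateSpace F n where
  toFun f := WithLp.toLp 2 fun x =>
    if h : x ∈ C then f (Submodule.Quotient.mk ⟨x, h⟩) else 0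
  map_add' f g := by
    ext x
    by_cases h : x ∈ C <;> simp [h]
  map_smul' c f := by
    ext x
    by_cases h : x ∈ C <;> simp [h]

theorem cssEncode_injective : Function.Injective (cssEncode C D) := by
  intro f g h
  funext c
  obtain ⟨⟨x, hx⟩, rfl⟩ := Submodule.Quotient.mk_surjective _ c
  have := congrArg (fun ψ : StateSpace F n => ψ x) h
  simpa [cssEncode, hx] using this

theorem range_cssEncode (hDC : D ≤ C) : LinearMap.range (cssEncode C D) = cssCode C D := by
  ext ψ
  rw [LinearMap.mem_range, mem_cssCode]
  constructor
  · rintro ⟨f, rfl⟩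
    refine ⟨fun x hx => by simp [cssEncode, hx], fun x d hd => ?_⟩
    by_cases hx : x ∈ C
    · have hxd : x + d ∈ C := C.add_mem hx (hDC hd)
      simp only [cssEncode, LinearMap.coe_mk, AddHom.coe_mk, hx, hxd, dite_true]
      congr 1
      rw [Submodule.Quotient.eq]
      simpa using hd
    · have hxd : x + d ∉ C := fun h => hx (by simpa using C.sub_mem h (hDC hd))
      simp [cssEncode, hx, hxd]
  · rintro ⟨h1, h2⟩
    refine ⟨fun c => ψ (Quotient.out c : C), ?_⟩
    ext x
    by_cases hx : x ∈ C
    · simp only [cssEncode, LinearMap.coe_mk, AddHom.coe_mk, hx, dite_true]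
      have hmk : (Submodule.Quotient.mk (Quotient.out (Submodule.Quotient.mk ⟨x, hx⟩ :
          C ⧸ D.comap C.subtype)) : C ⧸ D.comap C.subtype) = Submodule.Quotient.mk ⟨x, hx⟩ :=
        Quotient.out_eq _
      rw [Submodule.Quotient.eq] at hmk
      have := h2 x _ (by simpa using hmk)
      simpa using this
    · simp [cssEncode, hx, h1 x hx]

theorem finrank_cssCode [Fintype F] (hDC : D ≤ C) : Module.finrank ℂ (cssCode C D)
    = Fintype.card F ^ (Module.finrank F C - Module.finrank F D) := by
  classical
  have : Fintype (C ⧸ D.comap C.subtype) := Fintype.ofFinite _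
  rw [← range_cssEncode hDC, LinearMap.finrank_range_of_inj cssEncode_injective,
    Module.finrank_fintype_fun_eq_card, Module.card_eq_pow_finrank (K := F),
    Submodule.finrank_quotient, (Submodule.comapSubtypeEquivOfLe hDC).finrank_eq]

/-- The distance of `C` removes the off-diagonal entries of `E`; averaging over `D` makes its
diagonal constant. -/
theorem isLocallyPure_cssCode [Fintype F] [DecidableEq F] {k : ℕ}
    (hC : ∀ S : Finset (Fin n), S.card ≤ k → ∀ x ∈ C, (∀ i, i ∉ S → x i = 0) → x = 0)
    (hD : ∀ S : Finset (Fin n), S.card ≤ k → ∀ v : Fin n → F, ∃ d ∈ D, ∀ i ∈ S, d i = v i) :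
    IsLocallyPure (cssCode C D) k := by
  classical
  intro S E hS hE φ hφ ψ hψ
  rw [mem_cssCode] at hφ hψ
  have hdiag : inner ℂ φ (act E ψ) = ∑ x, star (φ x) * ψ x * E x x := by
    rw [inner_act]
    refine Finset.sum_congr rfl fun x _ => ?_
    rw [Finset.sum_eq_single x (fun y _ hyx => ?_) (by simp)]
    · ring
    by_cases hx : x ∈ C
    · by_cases hy : y ∈ C
      · rw [hE.eq_zero x y, mul_zero, zero_mul]
        -- Otherwise `y - x` is a word of `C` supported in `S`, hence zero.
        by_contra! h
        refine hyx (sub_eq_zero.1 (hC S hS (y - x) (C.sub_mem hy hx) fun i hi => ?_))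
        simp [h i hi]
      · rw [hψ.1 y hy, mul_zero]
    · rw [hφ.1 x hx, star_zero, zero_mul, zero_mul]
  have hinner : inner ℂ φ ψ = ∑ x, star (φ x) * ψ x := by
    rw [PiLp.inner_apply]
    exact Finset.sum_congr rfl fun x _ => mul_comm _ _
  let K : (Fin n → F) → ℂ := fun x => ∑ d : D, E (x + d) (x + d)
  have hK : ∀ x, K x = K 0 := by
    intro x
    -- As `d₀` agrees with `x` on `S`, translation by `x - d₀` does not affect `E`, and `d₀` itself
    -- is absorbed by the sum over `D`.
    obtain ⟨d₀, hd₀, h⟩ := hD S hS x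
    refine Fintype.sum_equiv (Equiv.addRight ⟨d₀, hd₀⟩) _ _ fun d => ?_
    have hw : ∀ i ∈ S, (x - d₀) i = 0 := fun i hi => by simp [h i hi]
    have := hE.add_right (x - d₀) hw (d + d₀) (d + d₀)
    have h3 : (d : Fin n → F) + d₀ + (x - d₀) = x + d := by abel
    rw [h3] at this
    simpa using this
  have havg : ∀ f : (Fin n → F) → ℂ, (∀ x, ∀ d ∈ D, f (x + d) = f x) →
      (Fintype.card D : ℂ) * ∑ x, f x * E x x = K 0 * ∑ x, f x := by
    intro f hf
    have h1 : ∀ d : D, ∑ x, f x * E x x = ∑ x, f x * E (x + d) (x + d) := fun d =>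
      (Fintype.sum_equiv (Equiv.addRight (d : Fin n → F)) _ _ fun x => by
        simp only [Equiv.coe_addRight, hf x d d.2]).symm
    calc (Fintype.card D : ℂ) * ∑ x, f x * E x x = ∑ _d : D, ∑ x, f x * E x x := by simp
      _ = ∑ d : D, ∑ x, f x * E (x + d) (x + d) := Finset.sum_congr rfl fun d _ => h1 d
      _ = ∑ x, f x * K x := by
        rw [Finset.sum_comm]
        exact Finset.sum_congr rfl fun x _ => (Finset.mul_sum _ _ _).symm
      _ = _ := by simp only [hK, ← Finset.sum_mul, mul_comm]
  have hcard : (Fintype.card D : ℂ) ≠ 0 := Nat.cast_ne_zero.2 Fintype.card_ne_zero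
  have hN : (Fintype.card F : ℂ) ^ n ≠ 0 :=
    pow_ne_zero _ (Nat.cast_ne_zero.2 Fintype.card_ne_zero)
  -- The constant function 1 identifies `K 0` with a multiple of the trace.
  have htr : (Fintype.card D : ℂ) * E.trace = K 0 * (Fintype.card F : ℂ) ^ n := by
    have := havg (fun _ => 1) fun _ _ _ => rfl
    simpa [Matrix.trace] using this
  have hφψ := havg (fun x => star (φ x) * ψ x) fun x d hd => by
    rw [hφ.2 x d hd, hψ.2 x d hd]
  rw [hdiag, hinner]
  apply mul_left_cancel₀ hcard
  rw [hφψ, ← mul_assoc, mul_div_assoc', htr, mul_div_cancel_right₀ _ hN]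

end CSS

end QuantumCode

/-! ### Polynomials without roots over a finite field -/

open Polynomial

theorem FiniteField.exists_irreducible_monic_natDegree_eq (F : Type*) [Field F] [Finite F] {m : ℕ}
    (hm : m ≠ 0) : ∃ f : F[X], f.Monic ∧ Irreducible f ∧ f.natDegree = m := by
  obtain ⟨p, hp⟩ := CharP.exists F
  have : Fact p.Prime := ⟨CharP.char_is_prime F p⟩
  have : NeZero m := ⟨hm⟩
  obtain ⟨α, hα⟩ := Field.exists_primitive_element_of_finite_bot F (FiniteField.Extension F p m)
  have hint : IsIntegral F α := Algebra.IsIntegral.isIntegral α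
  refine ⟨minpoly F α, minpoly.monic hint, minpoly.irreducible hint, ?_⟩
  rw [← IntermediateField.adjoin.finrank hint, hα, IntermediateField.finrank_top',
    FiniteField.finrank_extension]

theorem FiniteField.exists_monic_natDegree_eq_forall_eval_ne_zero (F : Type*) [Field F] [Finite F]
    {m : ℕ} (hm : m ≠ 1) : ∃ f : F[X], f.Monic ∧ f.natDegree = m ∧ ∀ a, f.eval a ≠ 0 := by
  rcases eq_or_ne m 0 with rfl | hm0
  · exact ⟨1, monic_one, natDegree_one, by simp⟩
  obtain ⟨f, hf, hirr, hdeg⟩ := exists_irreducible_monic_natDegree_eq F hm0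
  refine ⟨f, hf, hdeg, fun a ha => hm ?_⟩
  rw [← hdeg]
  exact natDegree_eq_of_degree_eq_some (degree_eq_one_of_irreducible_of_root hirr ha)

/-! ### Nested evaluation codes on the projective line -/

namespace ProjectiveEvaluation

variable {F : Type*} [Field F]

/-- The value of a polynomial of degree less than `m` at a point of the projective line, `none`
being the point at infinity. -/
noncomputable def evalAt (m : ℕ) : Option F → F[X] →ₗ[F] F
  | none => lcoeff F (m - 1)
  | some a => leval a

theorem evalAt_none (m : ℕ) (f : F[X]) : evalAt m none f = f.coeff (m - 1) := rfl

theorem evalAt_some (m : ℕ) (a : F) (f : F[X]) : evalAt m (some a) f = f.eval a := rfl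

/-- A zero at infinity lowers the degree below `m - 1`, which pays for the extra point. -/
theorem eq_zero_of_evalAt_eq_zero [DecidableEq F] {m : ℕ} {f : F[X]} (hf : f ∈ degreeLT F m)
    (T : Finset (Option F)) (hT : m ≤ T.card) (h : ∀ P ∈ T, evalAt m P f = 0) : f = 0 := by
  by_contra h0
  rw [mem_degreeLT, ← natDegree_lt_iff_degree_lt h0] at hf
  have hroots : (f.roots.toFinset.map Function.Embedding.some).card ≤ f.natDegree := by
    rw [Finset.card_map]
    exact (Multiset.toFinset_card_le _).trans (card_roots' f)
  have hsub : T ⊆ insert none (f.roots.toFinset.map Function.Embedding.some) := by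
    intro P hP
    match P, h P hP with
    | none, _ => simp
    | some a, ha => simpa [h0, evalAt_some] using ha
  by_cases hnone : none ∈ T
  · have hne : f.natDegree ≠ m - 1 := fun hd => by
      have := h none hnone
      rw [evalAt_none, ← hd] at this
      exact h0 (leadingCoeff_eq_zero.1 this)
    have := (Finset.card_le_card hsub).trans (Finset.card_insert_le _ _)
    omega
  · have := Finset.card_le_card ((Finset.subset_insert_iff_of_notMem hnone).1 hsub)
    omega

theorem finrank_degreeLT (m : ℕ) : Module.finrank F (degreeLT F m) = m := by
  rw [(degreeLTEquiv F m).finrank_eq, Module.finrank_fin_fun]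

/-- The evaluation map at `n` points of the projective line. -/
noncomputable def evalMap {n : ℕ} (P : Fin n → Option F) (m : ℕ) : F[X] →ₗ[F] (Fin n → F) :=
  LinearMap.pi fun i => evalAt m (P i)

theorem evalMap_apply {n : ℕ} (P : Fin n → Option F) (m : ℕ) (f : F[X]) (i : Fin n) :
    evalMap P m f i = evalAt m (P i) f := rfl

/-- A nested pair of codes of dimensions `k` and `n - k`, both maximum distance separable. -/
theorem exists_nested_mds {n k : ℕ} (hk : 2 * k ≤ n) (P : Fin n ↪ Option F) (h : F[X])
    (hmonic : h.Monic) (hdeg : h.natDegree = n - 2 * k)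
    (hP : ∀ i a, P i = some a → h.eval a ≠ 0) :
    ∃ C D : Submodule F (Fin n → F), D ≤ C ∧ Module.finrank F C = n - k ∧
      Module.finrank F D = k ∧
      (∀ S : Finset (Fin n), S.card ≤ k → ∀ x ∈ C, (∀ i, i ∉ S → x i = 0) → x = 0) ∧
      (∀ S : Finset (Fin n), S.card ≤ k → ∀ v : Fin n → F, ∃ d ∈ D, ∀ i ∈ S, d i = v i) := by
  classical
  have hmul_mem : ∀ g ∈ degreeLT F k, h * g ∈ degreeLT F (n - k) := by
    intro g hg
    rcases eq_or_ne g 0 with rfl | hg0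
    · simp
    rw [mem_degreeLT, ← natDegree_lt_iff_degree_lt hg0] at hg
    rw [mem_degreeLT, ← natDegree_lt_iff_degree_lt (mul_ne_zero hmonic.ne_zero hg0),
      natDegree_mul hmonic.ne_zero hg0]
    omega
  -- Multiplication by `h` creates no new zeros at the chosen points: at infinity because `h` is
  -- monic, elsewhere because `h` does not vanish.
  have hmul : ∀ g ∈ degreeLT F k, ∀ i, evalMap P (n - k) (h * g) i = 0 →
      evalMap P k g i = 0 := by
    intro g hg i hi
    rcases eq_or_ne g 0 with rfl | hg0
    · simp
    rw [evalMap_apply] at hi ⊢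
    rcases hPi : P i with _ | a
    · rw [hPi, evalAt_none] at hi
      rw [evalAt_none]
      rw [mem_degreeLT, ← natDegree_lt_iff_degree_lt hg0] at hg
      -- Here `k ≥ 1`, since `g ≠ 0`, so the subtraction is not truncated.
      have he : n - k - 1 = h.natDegree + (k - 1) := by omega
      rw [he, coeff_mul_add_eq_of_natDegree_le le_rfl (by omega), hmonic.coeff_natDegree, one_mul] at hi
      exact hi
    · rw [hPi, evalAt_some, eval_mul] at hi
      exact (mul_eq_zero.1 hi).resolve_left (hP i a hPi)
  have hvanish : ∀ (m : ℕ) (S : Finset (Fin n)), m ≤ S.card → ∀ f ∈ degreeLT F m,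
      (∀ i ∈ S, evalMap P m f i = 0) → f = 0 := by
    intro m S hS f hf hz
    refine eq_zero_of_evalAt_eq_zero hf (S.map P) (by rwa [Finset.card_map]) fun Q hQ => ?_
    obtain ⟨i, hi, rfl⟩ := Finset.mem_map.1 hQ
    exact hz i hi
  let cmap : degreeLT F (n - k) →ₗ[F] (Fin n → F) := (evalMap P (n - k)).domRestrict _
  let dmap : degreeLT F k →ₗ[F] (Fin n → F) :=
    (evalMap P (n - k) ∘ₗ LinearMap.mulLeft F h).domRestrict _
  have hdinj : ∀ S : Finset (Fin n), k ≤ S.card → ∀ g, (∀ i ∈ S, dmap g i = 0) → g = 0 :=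
    fun S hS g hg => Subtype.ext (hvanish k S hS g g.2 fun i hi => hmul g g.2 i (hg i hi))
  have hcinj : Function.Injective cmap := by
    refine (injective_iff_map_eq_zero cmap).2 fun f hf => Subtype.ext ?_
    exact hvanish (n - k) Finset.univ (by simp) f f.2 fun i _ => congrFun hf i
  have hdinj' : Function.Injective dmap := by
    refine (injective_iff_map_eq_zero dmap).2 fun f hf => ?_
    exact hdinj Finset.univ (by simp; omega) f fun i _ => congrFun hf i
  refine ⟨LinearMap.range cmap, LinearMap.range dmap, ?_, ?_, ?_, ?_, ?_⟩
  · rintro _ ⟨g, rfl⟩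
    exact ⟨⟨h * g, hmul_mem g g.2⟩, rfl⟩
  · rw [LinearMap.finrank_range_of_inj hcinj, finrank_degreeLT]
  · rw [LinearMap.finrank_range_of_inj hdinj', finrank_degreeLT]
  · rintro S hS _ ⟨f, rfl⟩ hz
    have : f = 0 := Subtype.ext <| hvanish (n - k) Sᶜ
      (by rw [Finset.card_compl, Fintype.card_fin]; omega) f f.2 fun i hi =>
        hz i (Finset.mem_compl.1 hi)
    rw [this, map_zero]
  · intro S hS v
    -- On exactly `k` coordinates, restriction is an injection between spaces of dimension `k`,
    -- hence onto.
    obtain ⟨T, hST, hT⟩ := Finset.exists_superset_card_eq hS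
      (by rw [Fintype.card_fin]; omega : k ≤ Fintype.card (Fin n))
    let r : degreeLT F k →ₗ[F] (T → F) := (LinearMap.funLeft F F Subtype.val) ∘ₗ dmap
    have hr : Function.Injective r := (injective_iff_map_eq_zero r).2 fun g hg =>
      hdinj T hT.ge g fun i hi => congrFun hg ⟨i, hi⟩
    have hfin : Module.finrank F (degreeLT F k) = Module.finrank F (T → F) := by
      rw [finrank_degreeLT, Module.finrank_fintype_fun_eq_card, Fintype.card_coe, hT]
    have : FiniteDimensional F (degreeLT F k) :=
      (degreeLTEquiv F k).symm.finiteDimensional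
    obtain ⟨g, hg⟩ := (LinearMap.injective_iff_surjective_of_finrank_eq_finrank hfin).1 hr
      fun i => v i
    exact ⟨dmap g, ⟨g, rfl⟩, fun i hi => congrFun hg ⟨i, hST hi⟩⟩

end ProjectiveEvaluation

/-! ### Choice of points and conclusion -/

theorem mainTheorem5 {F : Type*} [Field F] [Fintype F] [DecidableEq F] (n k : ℕ)
    (hn : 1 ≤ n) (hnq : n ≤ Fintype.card F + 1) (hk : 2 * k ≤ n)
    (hex : ¬ (n = Fintype.card F + 1 ∧ n = 2 * k + 1)) :
    ∃ Q : Submodule ℂ (QuantumCode.StateSpace F n), QuantumCode.IsMDS Q (n - 2 * k) (k + 1) := by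
  have hpts : ∃ (P : Fin n ↪ Option F) (h : F[X]), h.Monic ∧ h.natDegree = n - 2 * k ∧
      ∀ i a, P i = some a → h.eval a ≠ 0 := by
    by_cases h1 : n - 2 * k = 1
    -- A linear `h` has a root: take `X` and drop the point 0. The remaining `q` points suffice
    -- because `n = q + 1` is excluded here.
    · have hcard : Fintype.card (Fin n) ≤ Fintype.card {P : Option F // P ≠ some 0} := by
        rw [Fintype.card_subtype_compl, Fintype.card_option, Fintype.card_subtype_eq,
          Fintype.card_fin]
        omega
      obtain ⟨e⟩ := Function.Embedding.nonempty_of_card_le hcard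
      refine ⟨e.trans (Function.Embedding.subtype _), X, monic_X, by rw [natDegree_X, h1], ?_⟩
      intro i a hi
      rw [eval_X]
      rintro rfl
      exact (e i).2 hi
    · obtain ⟨h, hmonic, hdeg, hne⟩ :=
        FiniteField.exists_monic_natDegree_eq_forall_eval_ne_zero F h1
      have hcard : Fintype.card (Fin n) ≤ Fintype.card (Option F) := by
        rw [Fintype.card_option, Fintype.card_fin]
        exact hnq
      obtain ⟨P⟩ := Function.Embedding.nonempty_of_card_le hcard
      exact ⟨P, h, hmonic, hdeg, fun _ a _ => hne a⟩
  obtain ⟨P, h, hmonic, hdeg, hP⟩ := hpts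
  obtain ⟨C, D, hDC, hCdim, hDdim, hC, hD⟩ :=
    ProjectiveEvaluation.exists_nested_mds hk P h hmonic hdeg hP
  have hpure := QuantumCode.isLocallyPure_cssCode hC hD
  refine ⟨QuantumCode.cssCode C D, ⟨by omega, ?_, hpure.isPure.detects,
    hpure.corrects (by omega), fun _ => hpure.isPure⟩, by omega⟩
  rw [QuantumCode.finrank_cssCode hDC, hCdim, hDdim]
  congr 1
  omega
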